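/- Let $G$ be a locally path-connected, semilocally simply-connected topological group, with identity component $G_0$, component group $\pi_0(G)=G/G_0$, and universal covering group $\widetilde{G_0}\to G_0$, realised as the group of homotopy classes (relative to the end points) of paths in $G$ starting at $1$, under pointwise multiplication, with the map $[\gamma]\mapsto\gamma(1)$. Its kernel is the abelian group $\pi_1(G)$, on which $G$ acts by $g\cdot[\gamma]=[g\gamma g^{-1}]$; as $G_0$ acts trivially, $\pi_1(G)$ is also a $\pi_0(G)$-module. All cohomology is cohomology of abstract groups. Let $\mathrm{Opext}_G(G_0,\pi_1(G))$ be the set of $G$-equivariant congruence classes of extensions $1\to\pi_1(G)\to E\to G_0\to1$ with an action of $G$ on $E$ by automorphisms that extends the action on $\pi_1(G)$, covers the conjugation action on $G_0$, and restricts along $E\to G_0\subseteq G$ to conjugation in $E$. Let $\gamma:H^2(G,\pi_1(G))\to \mathrm{Opext}_G(G_0,\pi_1(G))$ send the class of an extension of $G$ by $\pi_1(G)$ to the class of its restriction to $G_0$, with the action of $G$ induced by conjugation. Let $\Psi$ be the class of $1\to\pi_1(G)\to\widetilde{G_0}\to G_0\to1$ with the action of $G$ by pointwise conjugation of paths, and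 let $E_\Psi=\gamma^{-1}(\Psi)\subseteq H^2(G,\pi_1(G))$. Let $\xi:H^2(\pi_0(G),\pi_1(G))\to H^2(G,\pi_1(G))$ be inflation, and let $\Delta:H^1(G_0,\pi_1(G))^{\pi_0(G)}\to H^2(\pi_0(G),\pi_1(G))$ be the transgression: an invariant class is a $G$-equivariant homomorphism $x:G_0\to\pi_1(G)$, and $\Delta(x)$ is the class of the cocycle $(p,q)\mapsto x(\bar p\,\bar q\,\overline{pq}^{\,-1})$, where $p\mapsto\bar p$ is a set-theoretic section of $G\to\pi_0(G)$. Put $Q=H^2(\pi_0(G),\pi_1(G))/\Delta(H^1(G_0,\pi_1(G))^{\pi_0(G)})$. Then: 1. The formula $\tau\cdot\mu=\mu+\xi(\tau)$ defines an action of $H^2(\pi_0(G),\pi_1(G))$ on $E_\Psi$. Any two elements of $E_\Psi$ are in the same orbit, and the stabilizer of each element of $E_\Psi$ is $\Delta(H^1(G_0,\pi_1(G))^{\pi_0(G)})$. In particular, if $E_\Psi\neq\emptyset$, the kernel of the action is $\Delta(H^1(G_0,\pi_1(G))^{\pi_0(G)})$. 2. The induced action of $Q$ on $E_\Psi$ is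 well defined and free, and any two elements of $E_\Psi$ are in the same orbit. 3. If $Q=0$ then $|E_\Psi|\le1$; if $E_\Psi\ne\emptyset$, then $Q=0$ if and only if $|E_\Psi|\le 1$. -/

import Mathlib

universe u

noncomputable section

namespace CoverUniqueness

open CategoryTheory groupCohomology

/-- A space is semilocally simply-connected if every point `x` has a neighbourhood `U` such that
every loop at `x` inside `U` is null-homotopic in the whole space, i.e. `π₁(U, x) → π₁(X, x)` is
trivial. -/
def SemilocallySimplyConnected (X : Type*) [TopologicalSpace X] : Prop :=
  ∀ x : X, ∃ U ∈ nhds x, ∀ γ : Path x x, (∀ t, γ t ∈ U) → γ.Homotopic (Path.refl x)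

section PathGroup

variable (G : Type u) [TopologicalSpace G] [Group G] [IsTopologicalGroup G]

/-- The group of paths `γ : [0,1] → G` with `γ 0 = 1`, under pointwise multiplication. -/
def BasedPaths : Subgroup C(unitInterval, G) where
  carrier := {γ | γ 0 = 1}
  one_mem' := rfl
  mul_mem' {a b} ha hb := by
    change a 0 = 1 at ha
    change b 0 = 1 at hb
    change a 0 * b 0 = 1
    rw [ha, hb, one_mul]
  inv_mem' {a} ha := by
    change a 0 = 1 at ha
    change (a 0)⁻¹ = 1
    rw [ha, inv_one]

/-- Homotopy relative to the end points is compatible with pointwise multiplication. -/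
def pathCon : Con (BasedPaths G) where
  r γ δ := ContinuousMap.HomotopicRel γ.1 δ.1 {0, 1}
  iseqv :=
    { refl := fun γ => ContinuousMap.HomotopicRel.refl γ.1
      symm := fun h => ContinuousMap.HomotopicRel.symm h
      trans := fun h h' => ContinuousMap.HomotopicRel.trans h h' }
  mul' := by
    rintro a b c d ⟨F⟩ ⟨K⟩
    refine ⟨⟨⟨⟨fun p => F p * K p, by fun_prop⟩, ?_, ?_⟩, ?_⟩⟩
    · intro x; simp
    · intro x; simp
    · intro t x hx
      have h1 := F.eq_fst t hx
      have h2 := K.eq_fst t hx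
      simp_all

/-- The universal covering group of the identity component of `G`: the homotopy classes, relative
to the end points, of paths in `G` that start at `1`, under pointwise multiplication. -/
abbrev UnivCover : Type u := (pathCon G).Quotient

/-- The covering map `⟦γ⟧ ↦ γ 1`. -/
def endpoint : UnivCover G →* G :=
  (pathCon G).lift
    { toFun := fun γ => γ.1 1
      map_one' := rfl
      map_mul' := fun _ _ => rfl }
    (by rintro a b h; exact ContinuousMap.HomotopicRel.fst_eq_snd h (by simp))

/-- The fundamental group `π₁(G, 1)`: the classes of loops in `UnivCover G`. -/
abbrev Pi1 : Subgroup (UnivCover G) := (endpoint G).ker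

/-- The identity component `G₀`. -/
abbrev G0 : Subgroup G := Subgroup.connectedComponentOfOne G

instance : (G0 G).Normal where
  conj_mem n hn g := by
    have h := (Continuous.image_connectedComponent_subset
      (f := fun x : G => g * x * g⁻¹) (by fun_prop) 1) ⟨n, hn, rfl⟩
    change g * n * g⁻¹ ∈ connectedComponent (1 : G)
    simpa using h

/-- The component group `π₀(G) = G/G₀`. -/
abbrev Pi0 : Type u := G ⧸ G0 G

/-- `G` acts on paths by pointwise conjugation. -/
instance : MulDistribMulAction G (BasedPaths G) where
  smul g γ := ⟨⟨fun t => g * γ.1 t * g⁻¹, by fun_prop⟩, by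
    have := γ.2
    change γ.1 0 = 1 at this
    change g * γ.1 0 * g⁻¹ = 1
    simp [this]⟩
  one_smul γ := by
    ext t; change 1 * γ.1 t * 1⁻¹ = γ.1 t; simp
  mul_smul g h γ := by
    ext t; change (g * h) * γ.1 t * (g * h)⁻¹ = g * (h * γ.1 t * h⁻¹) * g⁻¹; group
  smul_mul g γ δ := by
    ext t; change g * (γ.1 t * δ.1 t) * g⁻¹ = (g * γ.1 t * g⁻¹) * (g * δ.1 t * g⁻¹); group
  smul_one g := by
    ext t; change g * 1 * g⁻¹ = 1; group

lemma smul_path_apply (g : G) (γ : BasedPaths G) (t : unitInterval) :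
    (g • γ).1 t = g * γ.1 t * g⁻¹ := rfl

lemma pathCon_smul (g : G) {γ δ : BasedPaths G} (h : pathCon G γ δ) :
    pathCon G (g • γ) (g • δ) := by
  obtain ⟨F⟩ := h
  refine ⟨⟨⟨⟨fun p => g * F p * g⁻¹, by fun_prop⟩, ?_, ?_⟩, ?_⟩⟩
  · intro x; simp [smul_path_apply]
  · intro x; simp [smul_path_apply]
  · intro t x hx
    have h1 := F.eq_fst t hx
    simp_all [smul_path_apply]

/-- `G` acts on its universal covering group by pointwise conjugation of paths,
`g • ⟦γ(t)⟧ = ⟦g γ(t) g⁻¹⟧`. -/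
instance : MulDistribMulAction G (UnivCover G) where
  smul g := Quotient.map' (fun γ => g • γ) (fun _ _ h => pathCon_smul G g h)
  one_smul x := by
    induction x using Con.induction_on with | _ γ => exact congrArg _ (one_smul G γ)
  mul_smul g h x := by
    induction x using Con.induction_on with | _ γ => exact congrArg _ (mul_smul g h γ)
  smul_mul g x y := by
    induction x using Con.induction_on with | _ γ =>
    induction y using Con.induction_on with | _ δ => exact congrArg _ (smul_mul' g γ δ)
  smul_one g := congrArg _ (smul_one (N := BasedPaths G) g)

lemma smul_mk (g : G) (γ : BasedPaths G) :
    g • ((γ : UnivCover G)) = ((g • γ : BasedPaths G) : UnivCover G) := rfl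

lemma endpoint_mk (γ : BasedPaths G) : endpoint G (γ : UnivCover G) = γ.1 1 := rfl

lemma endpoint_smul (g : G) (x : UnivCover G) :
    endpoint G (g • x) = g * endpoint G x * g⁻¹ := by
  induction x using Con.induction_on with | _ γ => rfl

/-- The end point of `e` acts on the universal covering group as conjugation by `e`. -/
lemma endpoint_act (e x : UnivCover G) : endpoint G e • x = e * x * e⁻¹ := by
  induction e using Con.induction_on with | _ δ =>
  induction x using Con.induction_on with | _ γ =>
  rw [endpoint_mk, smul_mk]
  refine (Con.eq (pathCon G) (b := δ * γ * δ⁻¹)).2 ?_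
  have h0 : γ.1 0 = 1 := γ.2
  refine ContinuousMap.HomotopicRel.symm
    ⟨⟨⟨⟨fun p => δ.1 (max p.1 p.2) * γ.1 p.2 * (δ.1 (max p.1 p.2))⁻¹, by fun_prop⟩, ?_, ?_⟩, ?_⟩⟩
  · intro x
    simp
  · intro x
    have : max (1 : unitInterval) x = 1 := max_eq_left unitInterval.le_one'
    simp [this, smul_path_apply]
  · intro t x hx
    rcases hx with rfl | rfl
    · simp [h0]
    · have : max t (1 : unitInterval) = 1 := max_eq_right unitInterval.le_one'
      simp [this]

lemma pi1_central (z : Pi1 G) (x : UnivCover G) : z.1 * x = x * z.1 := by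
  have h := endpoint_act G z.1 x
  rw [show endpoint G z.1 = 1 from z.2, one_smul] at h
  rw [eq_mul_inv_iff_mul_eq] at h
  exact h.symm

instance : CommGroup (Pi1 G) where
  mul_comm a b := Subtype.ext (pi1_central G a b.1)

/-- The conjugation action of `G` on `π₁(G)`. -/
instance : MulDistribMulAction G (Pi1 G) where
  smul g z := ⟨g • z.1, by
    have h : endpoint G z.1 = 1 := z.2
    rw [MonoidHom.mem_ker, endpoint_smul, h]; group⟩
  one_smul z := Subtype.ext (one_smul G z.1)
  mul_smul g h z := Subtype.ext (mul_smul g h z.1)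
  smul_mul g z w := Subtype.ext (smul_mul' g z.1 w.1)
  smul_one g := Subtype.ext (smul_one (N := UnivCover G) g)

lemma coe_smul_pi1 (g : G) (z : Pi1 G) : ((g • z : Pi1 G) : UnivCover G) = g • z.1 := rfl

lemma endpoint_mem (x : UnivCover G) : endpoint G x ∈ G0 G := by
  induction x using Con.induction_on with | _ γ =>
  have h0 : γ.1 0 = 1 := γ.2
  have hj : Joined (1 : G) (γ.1 1) := ⟨⟨γ.1, h0, rfl⟩⟩
  exact pathComponent_subset_component _ hj

/-- The covering homomorphism onto the identity component. -/
def coverMap : UnivCover G →* G0 G := (endpoint G).codRestrict (G0 G) (endpoint_mem G)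

lemma coverMap_surjective [LocallyPathConnectedSpace G] : Function.Surjective (coverMap G) := by
  rintro ⟨g, hg⟩
  have hj : g ∈ pathComponent (1 : G) := by rw [pathComponent_eq_connectedComponent]; exact hg
  obtain ⟨p⟩ := hj
  exact ⟨((⟨p.toContinuousMap, p.source⟩ : BasedPaths G) : UnivCover G), Subtype.ext p.target⟩

/-- The identity component acts trivially on `π₁(G)`. -/
lemma smul_pi1_of_mem [LocallyPathConnectedSpace G] (n : G0 G) (z : Pi1 G) :
    (n : G) • z = z := by
  obtain ⟨e, rfl⟩ := coverMap_surjective G n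
  apply Subtype.ext
  rw [coe_smul_pi1, show ((coverMap G e : G0 G) : G) = endpoint G e from rfl, endpoint_act,
    ← pi1_central, mul_inv_cancel_right]

end PathGroup

section Algebra

variable {k H : Type u} [CommRing k] [Group H]

/-- An extension `1 → A → E → H → 1` of `H` by the `H`-module `A`, i.e. a group extension in which
conjugation induces the given `H`-action on `A`. -/
structure ModuleExtension (A : Rep.{u} k H) where
  /-- The middle group. -/
  E : Type u
  [group : Group E]
  /-- The short exact sequence. -/
  ext : GroupExtension (Multiplicative A) E H
  conj_inl : ∀ (e : E) (a : A),
    e * ext.inl (.ofAdd a) * e⁻¹ = ext.inl (.ofAdd (A.ρ (ext.rightHom e) a))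

attribute [instance] ModuleExtension.group

/-- An extension `1 → A → E → N → 1` of a normal subgroup `N` of `H` by the `H`-module `A`, equipped
with an action of `H` on `E` by automorphisms. The action extends the given one on `A`, covers the
conjugation action on `N`, and restricts along `E → N ⊆ H` to the conjugation action of `E` on
itself (so that `E → H` is a crossed module). -/
structure OperatorExtension (N : Subgroup H) (A : Rep.{u} k H) where
  /-- The middle group. -/
  E : Type u
  [group : Group E]
  /-- The short exact sequence. -/
  ext : GroupExtension (Multiplicative A) E N
  /-- The action of `H` on `E`. -/
  act : H →* MulAut E
  act_inl : ∀ (h : H) (a : A), act h (ext.inl (.ofAdd a)) = ext.inl (.ofAdd (A.ρ h a))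
  rightHom_act : ∀ (h : H) (e : E), (ext.rightHom (act h e) : H) = h * ext.rightHom e * h⁻¹
  act_rightHom : ∀ e x : E, act (ext.rightHom e : H) x = e * x * e⁻¹

attribute [instance] OperatorExtension.group

/-- Two operator extensions are congruent if there is an `H`-equivariant isomorphism of group
extensions between them, that is the identity on `A` and on `N`. -/
instance OperatorExtension.setoid (N : Subgroup H) (A : Rep.{u} k H) :
    Setoid (OperatorExtension N A) where
  r S T := ∃ φ : S.ext.Equiv T.ext, ∀ (h : H) (e : S.E), φ (S.act h e) = T.act h (φ e)
  iseqv :=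
    { refl := fun S => ⟨.refl S.ext, fun _ _ => rfl⟩
      symm := by
        rintro S T ⟨φ, hφ⟩
        refine ⟨φ.symm, fun h e => ?_⟩
        obtain ⟨x, rfl⟩ := φ.toMulEquiv.surjective e
        change φ.toMulEquiv.symm (T.act h (φ x)) = S.act h (φ.toMulEquiv.symm (φ.toMulEquiv x))
        rw [← hφ, MulEquiv.symm_apply_apply]
        exact φ.toMulEquiv.symm_apply_apply _
      trans := by
        rintro S T U ⟨φ, hφ⟩ ⟨ψ, hψ⟩
        refine ⟨φ.trans ψ, fun h e => ?_⟩
        change ψ (φ (S.act h e)) = U.act h (ψ (φ e))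
        rw [hφ, hψ] }

/-- `Opext_H(N, A)`: the set of congruence classes of operator extensions of `N` by `A`. -/
def Opext (N : Subgroup H) (A : Rep.{u} k H) : Type (u + 1) :=
  Quotient (OperatorExtension.setoid N A)

namespace ModuleExtension

variable {A : Rep.{u} k H} (S : ModuleExtension A) (N : Subgroup H)

/-- The preimage of `N` in the middle group. -/
abbrev preimage : Subgroup S.E := N.comap S.ext.rightHom

/-- The restriction of a group extension of `H` to a group extension of `N`. -/
def restrictExt : GroupExtension (Multiplicative A) (S.preimage N) N where
  inl := S.ext.inl.codRestrict (S.preimage N) (fun a => by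
    rw [Subgroup.mem_comap, S.ext.rightHom_inl]; exact N.one_mem)
  rightHom := S.ext.rightHom.subgroupComap N
  inl_injective a b h := S.ext.inl_injective (congrArg Subtype.val h)
  range_inl_eq_ker_rightHom := by
    ext ⟨x, hx⟩
    have h := SetLike.ext_iff.1 S.ext.range_inl_eq_ker_rightHom x
    rw [MonoidHom.mem_range, MonoidHom.mem_ker] at h ⊢
    constructor
    · rintro ⟨a, ha⟩
      exact Subtype.ext (h.1 ⟨a, congrArg Subtype.val ha⟩)
    · intro h'
      obtain ⟨a, ha⟩ := h.2 (congrArg Subtype.val h')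
      exact ⟨a, Subtype.ext ha⟩
  rightHom_surjective := by
    rintro ⟨n, hn⟩
    obtain ⟨e, rfl⟩ := S.ext.rightHom_surjective n
    exact ⟨⟨e, hn⟩, rfl⟩

/-- A set-theoretic lift of `h`. -/
def lift (h : H) : S.E := Function.surjInv S.ext.rightHom_surjective h

lemma rightHom_lift (h : H) : S.ext.rightHom (S.lift h) = h :=
  Function.surjInv_eq S.ext.rightHom_surjective h

variable [N.Normal]

/-- Elements of the middle group with the same image in `H` act in the same way on the preimage
of `N`, if `N` acts trivially on `A`. -/
lemma conjNormal_eq [Representation.IsTrivial (A.ρ.comp N.subtype)] {e e' : S.E}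
    (h : S.ext.rightHom e = S.ext.rightHom e') :
    (MulAut.conjNormal e : MulAut (S.preimage N)) = MulAut.conjNormal e' := by
  have h1 : e'⁻¹ * e ∈ S.ext.rightHom.ker := by
    rw [MonoidHom.mem_ker, map_mul, map_inv, h, inv_mul_cancel]
  rw [← S.ext.range_inl_eq_ker_rightHom] at h1
  obtain ⟨a, ha⟩ := h1
  have key : (MulAut.conjNormal (S.ext.inl a) : MulAut (S.preimage N)) = 1 := by
    ext x
    rw [MulAut.conjNormal_apply]
    have h2 := S.conj_inl x.1 a.toAdd
    have h3 : A.ρ (S.ext.rightHom x.1) a.toAdd = a.toAdd :=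
      LinearMap.congr_fun (Representation.isTrivial_def (A.ρ.comp N.subtype)
        ⟨S.ext.rightHom x.1, x.2⟩) a.toAdd
    rw [h3, ofAdd_toAdd, mul_inv_eq_iff_eq_mul] at h2
    rw [← h2, mul_inv_cancel_right]
    rfl
  have h4 : e = e' * S.ext.inl a := by rw [ha, mul_inv_cancel_left]
  rw [h4, map_mul, key, mul_one]

/-- The restriction of an extension of `H` to an operator extension of `N`: the group is the
preimage of `N`, and `h : H` acts on it as conjugation by any lift of `h`. -/
def restrict [Representation.IsTrivial (A.ρ.comp N.subtype)] : OperatorExtension N A where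
  E := S.preimage N
  ext := S.restrictExt N
  act :=
    { toFun := fun h => MulAut.conjNormal (S.lift h)
      map_one' := by
        rw [← map_one (MulAut.conjNormal (H := S.preimage N))]
        exact S.conjNormal_eq N (by rw [rightHom_lift, map_one])
      map_mul' := fun h h' => by
        rw [← map_mul]
        exact S.conjNormal_eq N (by simp only [map_mul, rightHom_lift]) }
  act_inl h a := by
    apply Subtype.ext
    change S.lift h * S.ext.inl (.ofAdd a) * (S.lift h)⁻¹ = S.ext.inl (.ofAdd (A.ρ h a))
    rw [S.conj_inl, rightHom_lift]
  rightHom_act h e := by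
    change S.ext.rightHom (S.lift h * e.1 * (S.lift h)⁻¹) = h * S.ext.rightHom e.1 * h⁻¹
    rw [map_mul, map_mul, map_inv, rightHom_lift]
  act_rightHom e x := by
    have := S.conjNormal_eq N
      (S.rightHom_lift (S.ext.rightHom e.1))
    change MulAut.conjNormal (S.lift (S.ext.rightHom e.1)) x = _
    rw [this]
    apply Subtype.ext
    rw [MulAut.conjNormal_apply]
    rfl

end ModuleExtension

section CocycleExtension

variable {A : Rep.{u} k H}

/-- The set `A × H`, that carries the extension of `H` by `A` defined by the 2-cocycle `f`. -/
@[ext]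
structure CocycleGroup (f : cocycles₂ A) where
  /-- The coordinate in `A`. -/
  left : A
  /-- The coordinate in `H`. -/
  right : H

variable (f : cocycles₂ A)

lemma rho_one_apply (A : Rep.{u} k H) (a : A) : A.ρ 1 a = a := by
  rw [map_one, Module.End.one_apply]

lemma cocycle_rel (g h j : H) :
    f (g * h, j) + f (g, h) = A.ρ g (f (h, j)) + f (g, h * j) :=
  (mem_cocycles₂_iff f.1).1 f.2 g h j

/-- The multiplication `(a, g)(b, h) = (a + g b + f(g, h), g h)`. -/
instance : Group (CocycleGroup f) where
  mul x y := ⟨x.left + A.ρ x.right y.left + f (x.right, y.right), x.right * y.right⟩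
  one := ⟨-f (1, 1), 1⟩
  inv x := ⟨-A.ρ x.right⁻¹ x.left - f (x.right⁻¹, x.right) - f (1, 1), x.right⁻¹⟩
  mul_assoc x y z := by
    ext
    · change x.left + A.ρ x.right y.left + f (x.right, y.right) + A.ρ (x.right * y.right) z.left +
        f (x.right * y.right, z.right) = x.left + A.ρ x.right (y.left + A.ρ y.right z.left +
        f (y.right, z.right)) + f (x.right, y.right * z.right)
      have h := cocycle_rel f x.right y.right z.right
      rw [map_add, map_add, map_mul, Module.End.mul_apply]
      rw [eq_sub_of_add_eq h]
      abel
    · exact mul_assoc x.right y.right z.right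
  one_mul x := by
    ext
    · change -f (1, 1) + A.ρ 1 x.left + f (1, x.right) = x.left
      rw [cocycles₂_map_one_fst f x.right, rho_one_apply]
      abel
    · exact one_mul x.right
  mul_one x := by
    ext
    · change x.left + A.ρ x.right (-f (1, 1)) + f (x.right, 1) = x.left
      rw [cocycles₂_map_one_snd f x.right, map_neg]
      abel
    · exact mul_one x.right
  inv_mul_cancel x := by
    ext
    · change -A.ρ x.right⁻¹ x.left - f (x.right⁻¹, x.right) - f (1, 1) + A.ρ x.right⁻¹ x.left +
        f (x.right⁻¹, x.right) = -f (1, 1)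
      abel
    · exact inv_mul_cancel x.right

lemma CocycleGroup.mul_left (x y : CocycleGroup f) :
    (x * y).left = x.left + A.ρ x.right y.left + f (x.right, y.right) := rfl

lemma CocycleGroup.mul_right (x y : CocycleGroup f) : (x * y).right = x.right * y.right := rfl

lemma CocycleGroup.one_left : (1 : CocycleGroup f).left = -f (1, 1) := rfl

/-- The extension `1 → A → A × H → H → 1` defined by a 2-cocycle. -/
def cocycleExtension : ModuleExtension A where
  E := CocycleGroup f
  ext :=
    { inl :=
        { toFun := fun a => ⟨a.toAdd - f (1, 1), 1⟩
          map_one' := by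
            ext
            · change (0 : A) - f (1, 1) = - f (1, 1)
              rw [zero_sub]
            · rfl
          map_mul' := fun a b => by
            ext
            · change a.toAdd + b.toAdd - f (1, 1) =
                a.toAdd - f (1, 1) + A.ρ 1 (b.toAdd - f (1, 1)) + f (1, 1)
              rw [rho_one_apply]
              abel
            · exact (mul_one (1 : H)).symm }
      rightHom :=
        { toFun := fun x => x.right
          map_one' := rfl
          map_mul' := fun _ _ => rfl }
      inl_injective := fun a b h => by
        have h1 : a.toAdd - f (1, 1) = b.toAdd - f (1, 1) := congrArg CocycleGroup.left h
        exact Multiplicative.toAdd.injective (sub_left_injective h1)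
      range_inl_eq_ker_rightHom := by
        ext x
        rw [MonoidHom.mem_range, MonoidHom.mem_ker]
        constructor
        · rintro ⟨a, rfl⟩
          rfl
        · intro h
          refine ⟨.ofAdd (x.left + f (1, 1)), ?_⟩
          ext
          · exact add_sub_cancel_right _ _
          · exact h.symm
      rightHom_surjective := fun h => ⟨⟨0, h⟩, rfl⟩ }
  conj_inl e a := by
    rw [mul_inv_eq_iff_eq_mul]
    ext
    · change e.left + A.ρ e.right (a - f (1, 1)) + f (e.right, 1) =
        A.ρ e.right a - f (1, 1) + A.ρ 1 e.left + f (1, e.right)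
      rw [cocycles₂_map_one_fst f e.right, cocycles₂_map_one_snd f e.right, map_sub, rho_one_apply]
      abel
    · exact (mul_one e.right).trans (one_mul e.right).symm

end CocycleExtension

section Gamma

variable (N : Subgroup H) [N.Normal] (A : Rep.{u} k H) [Representation.IsTrivial (A.ρ.comp N.subtype)]

lemma H2π_surjective : Function.Surjective (H2π A) := by
  intro x
  induction x using H2_induction_on with | _ f => exact ⟨f, rfl⟩

/-- The map `γ : H²(H, A) → Opext_H(N, A)`, that sends the class of a 2-cocycle to the class of
the restriction to `N` of the group extension that the cocycle defines. -/
def gamma (x : H2 A) : Opext N A :=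
  Quotient.mk _ ((cocycleExtension (Function.surjInv (H2π_surjective A) x)).restrict N)

/-- Any isomorphism of extensions of `H` restricts to a congruence of operator extensions. -/
lemma restrict_equiv (S T : ModuleExtension A) (φ : S.ext.Equiv T.ext) :
    S.restrict N ≈ T.restrict N := by
  have hr : ∀ e, T.ext.rightHom (φ e) = S.ext.rightHom e := φ.rightHom_map
  let ψ : S.preimage N →* T.preimage N :=
    { toFun := fun x => ⟨φ x.1, by rw [Subgroup.mem_comap, hr]; exact x.2⟩
      map_one' := Subtype.ext (map_one φ)
      map_mul' := fun x y => Subtype.ext (map_mul φ x.1 y.1) }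
  refine ⟨GroupExtension.Equiv.ofMonoidHom ψ ?_ ?_, fun h e => ?_⟩
  · refine MonoidHom.ext fun a => ?_
    exact Subtype.ext (φ.map_inl a)
  · refine MonoidHom.ext fun x => ?_
    exact Subtype.ext (φ.rightHom_map x.1)
  · change ψ ((S.restrict N).act h e) = (T.restrict N).act h (ψ e)
    have h1 := T.conjNormal_eq N (e := φ (S.lift h))
      (e' := T.lift h)
      (by rw [hr, S.rightHom_lift, T.rightHom_lift])
    change _ = (MulAut.conjNormal (T.lift h) :
      MulAut (T.preimage N)) (ψ e)
    rw [← h1]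
    apply Subtype.ext
    change φ (S.lift h * e.1 * (S.lift h)⁻¹) = φ (S.lift h) * φ e.1 * (φ (S.lift h))⁻¹
    rw [map_mul, map_mul, map_inv]

/-- `γ` does not depend on the choice of the cocycle. -/
lemma gamma_H2π (f : cocycles₂ A) :
    gamma N A (H2π A f) = Quotient.mk _ ((cocycleExtension f).restrict N) := by
  set f' := Function.surjInv (H2π_surjective A) (H2π A f) with hf'
  have h : H2π A f' = H2π A f := Function.surjInv_eq _ _
  rw [H2π_eq_iff] at h
  obtain ⟨c, hc⟩ := h
  have hc' : ∀ g h : H, A.ρ g (c h) - c (g * h) + c g = f' (g, h) - f (g, h) :=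
    fun g h => congrFun hc (g, h)
  refine Quotient.sound (restrict_equiv N A _ _ (GroupExtension.Equiv.ofMonoidHom
    { toFun := fun x => ⟨x.left + c x.right, x.right⟩
      map_one' := ?_
      map_mul' := fun x y => ?_ } ?_ ?_))
  · apply CocycleGroup.ext
    · change -f' (1, 1) + c 1 = -f (1, 1)
      have := hc' 1 1
      rw [mul_one, rho_one_apply, sub_self, zero_add] at this
      rw [this]
      abel
    · rfl
  · apply CocycleGroup.ext
    · change x.left + A.ρ x.right y.left + f' (x.right, y.right) + c (x.right * y.right) =
        x.left + c x.right + A.ρ x.right (y.left + c y.right) + f (x.right, y.right)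
      rw [sub_eq_iff_eq_add.1 (hc' x.right y.right).symm, map_add]
      abel
    · rfl
  · refine MonoidHom.ext fun a => ?_
    apply CocycleGroup.ext
    · change a.toAdd - f' (1, 1) + c 1 = a.toAdd - f (1, 1)
      have := hc' 1 1
      rw [mul_one, rho_one_apply, sub_self, zero_add] at this
      rw [this]
      abel
    · rfl
  · exact MonoidHom.ext fun x => rfl

/-- The inflation map `ξ : H²(H/N, A) → H²(H, A)`. -/
def inflation : H2 (A.ofQuotient N) →ₗ[k] H2 A :=
  (map (QuotientGroup.mk' N) (Rep.resOfQuotientIso A N).hom 2).hom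

end Gamma

section Delta

variable (N : Subgroup H) [N.Normal] (A : Rep.{u} k H)

/-- The homomorphism `n ↦ h⁻¹ n h` of `N`. -/
def conjInv (h : H) : N →* N := (MulAut.conjNormal h⁻¹ : MulAut N).toMonoidHom

/-- The action of `h` on the coefficients, as a morphism of representations of `N` from `A` with
the action twisted by `n ↦ h⁻¹ n h`. -/
def coeffMap (h : H) : Rep.res (conjInv N h) (Rep.res N.subtype A) ⟶ Rep.res N.subtype A :=
  Rep.ofHom ⟨A.ρ h, fun n => by
    change A.ρ h ∘ₗ A.ρ ((conjInv N h n : N) : H) = A.ρ (n : H) ∘ₗ A.ρ h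
    rw [← Module.End.mul_eq_comp, ← Module.End.mul_eq_comp, ← map_mul, ← map_mul]
    congr 1
    change h * (h⁻¹ * n * h⁻¹⁻¹) = n * h
    group⟩

/-- The action of `h` on `H¹(N, A)`, induced by `f ↦ (n ↦ h f(h⁻¹ n h))` on cocycles. -/
def H1conj (h : H) : H1 (Rep.res N.subtype A) →ₗ[k] H1 (Rep.res N.subtype A) :=
  (map (conjInv N h) (coeffMap N A h) 1).hom

lemma H1conj_H1π (h : H) (f : cocycles₁ (Rep.res N.subtype A)) :
    H1conj N A h (H1π _ f) = H1π _ (mapCocycles₁ (conjInv N h) (coeffMap N A h) f) :=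
  H1π_comp_map_apply (conjInv N h) (coeffMap N A h) f

lemma mapCocycles₁_conj_apply (h : H) (f : cocycles₁ (Rep.res N.subtype A)) (n : N) :
    (mapCocycles₁ (conjInv N h) (coeffMap N A h) f) n = A.ρ h (f (conjInv N h n)) := rfl

/-- The conjugation representation of `H` on `H¹(N, A)`. -/
def H1rep : Representation k H (H1 (Rep.res N.subtype A)) where
  toFun := H1conj N A
  map_one' := by
    ext x
    induction x using H1_induction_on with | _ f =>
    rw [H1conj_H1π, Module.End.one_apply]
    congr 1
    ext n
    rw [mapCocycles₁_conj_apply, map_one, Module.End.one_apply]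
    congr 1
    apply Subtype.ext
    change (1 : H)⁻¹ * n * (1 : H)⁻¹⁻¹ = n
    group
  map_mul' g h := by
    ext x
    induction x using H1_induction_on with | _ f =>
    rw [Module.End.mul_apply, H1conj_H1π, H1conj_H1π, H1conj_H1π]
    congr 1
    ext n
    rw [mapCocycles₁_conj_apply, mapCocycles₁_conj_apply, mapCocycles₁_conj_apply, map_mul,
      Module.End.mul_apply]
    congr 3
    apply Subtype.ext
    change (g * h)⁻¹ * n * (g * h)⁻¹⁻¹ = h⁻¹ * (g⁻¹ * n * g⁻¹⁻¹) * h⁻¹⁻¹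
    group

variable [Representation.IsTrivial (A.ρ.comp N.subtype)]

instance : (Rep.res N.subtype A).IsTrivial := inferInstanceAs (Representation.IsTrivial (A.ρ.comp N.subtype))

lemma rho_of_mem (n : N) (a : A) : A.ρ (n : H) a = a :=
  LinearMap.congr_fun (Representation.isTrivial_def (A.ρ.comp N.subtype) n) a

lemma cocycles₁_mul (f : cocycles₁ (Rep.res N.subtype A)) (m n : N) :
    f (m * n) = f m + f n := cocycles₁_map_mul_of_isTrivial f m n

/-- `N` acts trivially on `H¹(N, A)`. -/
instance : Representation.IsTrivial ((H1rep N A).comp N.subtype) where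
  out n := by
    ext x
    induction x using H1_induction_on with | _ f =>
    change H1conj N A (n : H) (H1π _ f) = H1π _ f
    rw [H1conj_H1π]
    congr 1
    ext m
    rw [mapCocycles₁_conj_apply, rho_of_mem]
    have : conjInv N (n : H) m = n⁻¹ * m * n := by
      apply Subtype.ext
      change (n : H)⁻¹ * m * (n : H)⁻¹⁻¹ = (n : H)⁻¹ * m * n
      group
    rw [this, cocycles₁_mul, cocycles₁_mul, add_comm, ← add_assoc, ← cocycles₁_mul,
      mul_inv_cancel, cocycles₁_map_one, zero_add]

/-- `H¹(N, A)^{H/N}`, the invariants of the conjugation action of `H/N` on `H¹(N, A)`. -/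
def H1inv : Submodule k (H1 (Rep.res N.subtype A)) := ((H1rep N A).ofQuotient N).invariants

/-- As `N` acts trivially on `A`, a class in `H¹(N, A)` is a homomorphism from `N` to `A`. -/
def homOfH1 : H1 (Rep.res N.subtype A) →ₗ[k] (Additive N →+ A) :=
  (H1IsoOfIsTrivial (Rep.res N.subtype A)).hom.hom

lemma homOfH1_H1π (f : cocycles₁ (Rep.res N.subtype A)) (n : N) :
    homOfH1 N A (H1π _ f) (.ofMul n) = f n :=
  H1IsoOfIsTrivial_H1π_apply_apply (A := Rep.res N.subtype A) f (.ofMul n)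

/-- A homomorphism from `N` to `A` that represents an invariant class is `H`-equivariant. -/
lemma homOfH1_conj (x : H1inv N A) (h : H) (n m : N) (hm : (m : H) = h * n * h⁻¹) :
    homOfH1 N A x.1 (.ofMul m) = A.ρ h (homOfH1 N A x.1 (.ofMul n)) := by
  obtain ⟨x, hx⟩ := x
  have hx' : H1conj N A h x = x := hx (h : H ⧸ N)
  change homOfH1 N A x _ = A.ρ h (homOfH1 N A x _)
  conv_lhs => rw [← hx']
  induction x using H1_induction_on with | _ f =>
  rw [H1conj_H1π, homOfH1_H1π, homOfH1_H1π]
  change A.ρ h (f (conjInv N h m)) = A.ρ h (f n)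
  congr 2
  apply Subtype.ext
  change h⁻¹ * m * h⁻¹⁻¹ = n
  rw [hm]; group

/-- The element `s(p) s(q) s(pq)⁻¹` of `N`, where `s` is a set-theoretic section of `H → H/N`. -/
def factorSet (p q : H ⧸ N) : N :=
  ⟨p.out * q.out * (p * q).out⁻¹, by
    rw [← QuotientGroup.eq_one_iff]
    simp⟩

/-- The 2-cocycle `(p, q) ↦ x(s(p) s(q) s(pq)⁻¹)` of `H/N`. -/
def deltaCocycle (x : H1inv N A) : cocycles₂ (A.ofQuotient N) :=
  ⟨fun pq => homOfH1 N A x.1 (.ofMul (factorSet N pq.1 pq.2)), by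
    rw [mem_cocycles₂_iff]
    intro p q r
    let m : N := ⟨p.out * (factorSet N q r : H) * p.out⁻¹,
      Subgroup.Normal.conj_mem inferInstance _ (factorSet N q r).2 _⟩
    have h1 : (A.ofQuotient N).ρ p (homOfH1 N A x.1 (.ofMul (factorSet N q r))) =
        homOfH1 N A x.1 (.ofMul m) := by
      rw [homOfH1_conj N A x p.out (factorSet N q r) m rfl]
      conv_lhs => rw [← QuotientGroup.out_eq' p]
      rfl
    have h2 : factorSet N p q * factorSet N (p * q) r = m * factorSet N p (q * r) := by
      apply Subtype.ext
      change (p.out * q.out * (p * q).out⁻¹) * ((p * q).out * r.out * (p * q * r).out⁻¹) =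
        (p.out * (q.out * r.out * (q * r).out⁻¹) * p.out⁻¹) *
          (p.out * (q * r).out * (p * (q * r)).out⁻¹)
      rw [mul_assoc p q r]
      group
    have h3 : homOfH1 N A x.1 (.ofMul (factorSet N p q)) +
        homOfH1 N A x.1 (.ofMul (factorSet N (p * q) r)) =
        homOfH1 N A x.1 (.ofMul m) + homOfH1 N A x.1 (.ofMul (factorSet N p (q * r))) := by
      rw [← map_add (homOfH1 N A x.1), ← map_add (homOfH1 N A x.1), ← ofMul_mul, ← ofMul_mul, h2]
    exact (add_comm _ _).trans (h3.trans (congrArg₂ (· + ·) h1.symm rfl))⟩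

/-- The map `Δ : H¹(N, A)^{H/N} → H²(H/N, A)` (the transgression). An invariant class is an
`H`-equivariant homomorphism `x : N → A`; its image is the class of the extension of `H/N` by `A`
obtained from `1 → N → H → H/N → 1` by pushing out along `x`. -/
def delta : H1inv N A →ₗ[k] H2 (A.ofQuotient N) :=
  (H2π (A.ofQuotient N)).hom ∘ₗ
    { toFun := deltaCocycle N A
      map_add' := fun x y => by
        ext p q
        change homOfH1 N A (x.1 + y.1) _ = _
        rw [map_add]
        rfl
      map_smul' := fun c x => by
        ext p q
        change homOfH1 N A (c • x.1) _ = _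
        rw [map_smul]
        rfl }

end Delta

end Algebra

section Main

variable (G : Type u) [TopologicalSpace G] [Group G] [IsTopologicalGroup G]

/-- The action of `G` on `π₁(G)`, written additively. -/
instance : DistribMulAction G (Additive (Pi1 G)) where
  smul g z := .ofMul (g • z.toMul)
  one_smul z := congrArg Additive.ofMul (one_smul G z.toMul)
  mul_smul g h z := congrArg Additive.ofMul (mul_smul g h z.toMul)
  smul_zero g := congrArg Additive.ofMul (smul_one (N := Pi1 G) g)
  smul_add g z w := congrArg Additive.ofMul (smul_mul' g z.toMul w.toMul)

/-- The coefficient ring `ℤ`, lifted to the universe of `G`. -/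
def IntU : Type u := ULift.{u} ℤ

instance : CommRing IntU.{u} := inferInstanceAs (CommRing (ULift.{u} ℤ))

/-- The `ℤ`-module structure of the abelian group `π₁(G)`. -/
instance : Module IntU.{u} (Additive (Pi1 G)) :=
  inferInstanceAs (Module (ULift.{u} ℤ) (Additive (Pi1 G)))

instance : SMulCommClass G IntU.{u} (Additive (Pi1 G)) where
  smul_comm g n z := map_zsmul (DistribSMul.toAddMonoidHom (Additive (Pi1 G)) g) n.down z

/-- `π₁(G)`, written additively, as a `G`-module. -/
abbrev pi1Rep : Rep.{u} IntU.{u} G :=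
  Rep.of (Representation.ofDistribMulAction IntU.{u} G (Additive (Pi1 G)))

variable [LocallyPathConnectedSpace G]

instance : Representation.IsTrivial ((pi1Rep G).ρ.comp (G0 G).subtype) where
  out n := LinearMap.ext fun z => congrArg Additive.ofMul (smul_pi1_of_mem G n z.toMul)

/-- `π₁(G)` as a `π₀(G)`-module. -/
abbrev pi1Rep0 : Rep.{u} IntU.{u} (Pi0 G) := (pi1Rep G).ofQuotient (G0 G)

/-- The extension `1 → π₁(G) → G̃₀ → G₀ → 1` given by the universal covering group of `G₀`, with
the action of `G` by pointwise conjugation of paths. -/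
def univCoverExtension : OperatorExtension (G0 G) (pi1Rep G) where
  E := UnivCover G
  ext :=
    { inl :=
        { toFun := fun z => (Additive.toMul (Multiplicative.toAdd z : Additive (Pi1 G)) : Pi1 G).1
          map_one' := rfl
          map_mul' := fun _ _ => rfl }
      rightHom := coverMap G
      inl_injective := fun _ _ h => Subtype.ext h
      range_inl_eq_ker_rightHom := by
        ext x
        rw [MonoidHom.mem_range, MonoidHom.mem_ker]
        constructor
        · rintro ⟨z, rfl⟩
          exact Subtype.ext (Additive.toMul (Multiplicative.toAdd z : Additive (Pi1 G)) : Pi1 G).2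
        · intro h
          exact ⟨.ofAdd (Additive.ofMul (⟨x, congrArg Subtype.val h⟩ : Pi1 G)), rfl⟩
      rightHom_surjective := coverMap_surjective G }
  act := MulDistribMulAction.toMulAut G (UnivCover G)
  act_inl _ _ := rfl
  rightHom_act h e := endpoint_smul G h e
  act_rightHom e x := endpoint_act G e x

/-- The class `Ψ` in `Opext_G(G₀, π₁(G))` of the universal covering group of `G₀`. -/
def Psi : Opext (G0 G) (pi1Rep G) := Quotient.mk _ (univCoverExtension G)

/-- The fibre `E_Ψ = γ⁻¹(Ψ)` in `H²(G, π₁(G))`. -/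
def EPsi : Set (H2 (pi1Rep G)) := gamma (G0 G) (pi1Rep G) ⁻¹' {Psi G}

/-- The image `Δ(H¹(G₀, π₁(G))^{π₀(G)})` in `H²(π₀(G), π₁(G))`. -/
def imDelta : Submodule IntU.{u} (H2 (pi1Rep0 G)) :=
  LinearMap.range (delta (G0 G) (pi1Rep G))

end Main

end CoverUniqueness

end

open CoverUniqueness
open groupCohomology (H2)

/-!
Everything here holds for a group `H`, a normal subgroup `N` and an `H`-module `A` on which `N` acts
trivially. The topology of `G` enters the proof only through the fact that `G₀` acts trivially on
`π₁(G)`, which is part of the construction of the modules. The theorem rests on two exactness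
statements.

* *The fibres of `γ` are the cosets of the image of inflation*
  (`gamma_add_inflation`, `exists_inflation_eq_sub`). In terms of 2-cocycles `f`, `f'` of `H`, a
  congruence between the restrictions to `N` is a map `(a, n) ↦ (a + u(n), n)`, where the cochain
  `u` on `N` satisfies one identity for multiplicativity and one for equivariance
  (`restrict_cocycleExtension_equiv_of_cochain`,
  `exists_cochain_of_restrict_cocycleExtension_equiv`). An inflated cocycle is constant on `N`, and
  then a constant `u` works. Conversely, `u` splits the extension with cocycle `f - f'` over `N`,
  equivariantly. Continuing this splitting to a section on `H` by means of representatives of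
  `H/N` replaces `f - f'` by a cohomologous cocycle that is invariant under translation by `N`, i.e.
  that is inflated.

* *The kernel of inflation is the image of `Δ`* (`inflation_eq_zero_iff`), the exactness of the
  inflation-restriction sequence at `H²(H/N, A)`, shown directly with cochains.

So `H²(π₀(G), π₁(G))` acts on the fibre `E_Ψ` transitively by translations through inflation, and
each stabilizer is the kernel of inflation. The claims on the quotient `Q` follow formally.
-/

noncomputable section

namespace CoverUniqueness

open CategoryTheory groupCohomology

/-! ### Congruences between restrictions of cocycle extensions -/

section RestrictedExtension

variable {k H : Type u} [CommRing k] [Group H] {A : Rep.{u} k H} (N : Subgroup H) [N.Normal]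
  [Representation.IsTrivial (A.ρ.comp N.subtype)]

/-- In the restriction of an extension to `N`, any lift `e` of `h`, not only the chosen one,
computes the action of `h`. -/
lemma ModuleExtension.restrict_act_apply (S : ModuleExtension A) (h : H) (e : S.E)
    (he : S.ext.rightHom e = h) (x : S.preimage N) :
    (S.restrict N).act h x = (MulAut.conjNormal e x : S.preimage N) := by
  have h1 := S.conjNormal_eq N (e := S.lift h) (e' := e) (by rw [S.rightHom_lift, he])
  change (MulAut.conjNormal (S.lift h) x : S.preimage N) = _
  rw [h1]

/-- The pair `(a, n)` with `n : N`, as an element of the preimage of `N` in the extension of `H`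
defined by a 2-cocycle. -/
def preimageMk (f : cocycles₂ A) (a : A) (n : N) : (cocycleExtension f).preimage N :=
  ⟨(⟨a, n⟩ : CocycleGroup f), n.2⟩

omit [N.Normal] [Representation.IsTrivial (A.ρ.comp N.subtype)] in
lemma preimageMk_left_inj {f : cocycles₂ A} {a b : A} {n m : N}
    (h : preimageMk N f a n = preimageMk N f b m) : a = b :=
  congrArg (fun x => (x.1 : CocycleGroup f).left) h

lemma preimageMk_mul (f : cocycles₂ A) (a b : A) (n m : N) :
    preimageMk N f a n * preimageMk N f b m = preimageMk N f (a + b + f (n, m)) (n * m) := by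
  refine Subtype.ext (CocycleGroup.ext ?_ rfl)
  change a + A.ρ (n : H) b + f (n, m) = a + b + f (n, m)
  rw [rho_of_mem]

lemma restrict_act_preimageMk (f : cocycles₂ A) (h : H) (a : A) (n m : N)
    (hm : (m : H) = h * n * h⁻¹) :
    ((cocycleExtension f).restrict N).act h (preimageMk N f a n) =
      preimageMk N f (A.ρ h a + f (h, n) - f (m, h)) m := by
  refine ((cocycleExtension f).restrict_act_apply N h (⟨0, h⟩ : CocycleGroup f) rfl _).trans ?_
  refine Subtype.ext ((MulAut.conjNormal_apply _ _).trans (mul_inv_eq_iff_eq_mul.2 ?_))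
  apply CocycleGroup.ext
  · change (0 : A) + A.ρ h a + f (h, n) = A.ρ h a + f (h, n) - f (m, h) + A.ρ m 0 + f (m, h)
    rw [map_zero]
    abel
  · change h * n = m * h
    rw [hm]
    group

/-- A cochain `u` on `N` whose coboundary is the difference of two cocycles on `N`, and which is
compatible with the conjugation actions, gives a congruence `(a, n) ↦ (a + u(n), n)` of the
restricted extensions. -/
lemma restrict_cocycleExtension_equiv_of_cochain (f f' : cocycles₂ A) (u : N → A)
    (hmul : ∀ n m : N, f (n, m) + u (n * m) = u n + u m + f' (n, m))
    (hconj : ∀ (h : H) (n m : N), (m : H) = h * n * h⁻¹ →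
      A.ρ h (u n) + f' (h, n) - f' (m, h) = u m + f (h, n) - f (m, h)) :
    (cocycleExtension f).restrict N ≈ (cocycleExtension f').restrict N := by
  have hone : f (1, 1) = u 1 + f' (1, 1) := by
    have := hmul 1 1
    rw [mul_one, add_comm, add_assoc] at this
    exact add_left_cancel this
  let φ : (cocycleExtension f).preimage N →* (cocycleExtension f').preimage N :=
    { toFun := fun x => preimageMk N f' ((x.1 : CocycleGroup f).left +
        u ⟨(x.1 : CocycleGroup f).right, x.2⟩) ⟨(x.1 : CocycleGroup f).right, x.2⟩
      map_one' := by
        refine Subtype.ext (CocycleGroup.ext ?_ rfl)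
        change -f (1, 1) + u 1 = -f' (1, 1)
        rw [hone]
        abel
      map_mul' := by
        rintro ⟨⟨a, n⟩, hn⟩ ⟨⟨b, m⟩, hm⟩
        refine Subtype.ext (CocycleGroup.ext ?_ rfl)
        change a + A.ρ n b + f (n, m) + u (⟨n, hn⟩ * ⟨m, hm⟩) =
          a + u ⟨n, hn⟩ + A.ρ n (b + u ⟨m, hm⟩) + f' (n, m)
        rw [add_assoc _ (f (n, m)), hmul ⟨n, hn⟩ ⟨m, hm⟩, map_add,
          rho_of_mem N A ⟨n, hn⟩ (u _)]
        abel }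
  have hφ (a : A) (n : N) : φ (preimageMk N f a n) = preimageMk N f' (a + u n) n := rfl
  refine ⟨GroupExtension.Equiv.ofMonoidHom φ ?_ ?_, fun h x => ?_⟩
  · refine MonoidHom.ext fun a => Subtype.ext (CocycleGroup.ext ?_ rfl)
    change a.toAdd - f (1, 1) + u 1 = a.toAdd - f' (1, 1)
    rw [hone]
    abel
  · exact MonoidHom.ext fun x => rfl
  · obtain ⟨⟨a, n⟩, hn⟩ := x
    lift n to N using hn
    let m : N := ⟨h * n * h⁻¹, Subgroup.Normal.conj_mem inferInstance _ n.2 _⟩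
    have h1 := restrict_act_preimageMk N f h a n m rfl
    have h2 := restrict_act_preimageMk N f' h (a + u n) n m rfl
    refine (congrArg φ h1).trans (Eq.trans ?_ h2.symm)
    rw [hφ, map_add, add_assoc, add_sub_assoc (A.ρ h a) _ (f' (m, h)), hconj h n m rfl]
    congr 1
    abel

/-- Conversely, every congruence of the restricted extensions has the form
`(a, n) ↦ (a + u(n), n)`. -/
lemma exists_cochain_of_restrict_cocycleExtension_equiv (f f' : cocycles₂ A)
    (hff' : (cocycleExtension f).restrict N ≈ (cocycleExtension f').restrict N) :
    ∃ u : N → A,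
      (∀ n m : N, f (n, m) + u (n * m) = u n + u m + f' (n, m)) ∧
      (∀ (h : H) (n m : N), (m : H) = h * n * h⁻¹ →
        A.ρ h (u n) + f' (h, n) - f' (m, h) = u m + f (h, n) - f (m, h)) := by
  obtain ⟨φ, hφ⟩ := hff'
  let ψ : (cocycleExtension f).preimage N ≃* (cocycleExtension f').preimage N := φ.toMulEquiv
  let u : N → A := fun n => ((ψ (preimageMk N f 0 n)).1 : CocycleGroup f').left
  have hu (n : N) : ψ (preimageMk N f 0 n) = preimageMk N f' (u n) n :=
    Subtype.ext (CocycleGroup.ext rfl (congrArg Subtype.val (φ.rightHom_map (preimageMk N f 0 n))))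
  have hinl (a : A) :
      ψ (preimageMk N f (a - f (1, 1)) 1) = preimageMk N f' (a - f' (1, 1)) 1 :=
    φ.map_inl (.ofAdd a)
  have hone (g : cocycles₂ A) (a b : A) (n : N) :
      preimageMk N g (a - g (1, 1)) 1 * preimageMk N g b n = preimageMk N g (a + b) n := by
    rw [preimageMk_mul, one_mul, OneMemClass.coe_one, cocycles₂_map_one_fst g (n : H)]
    congr 1
    abel
  have hψ (a : A) (n : N) : ψ (preimageMk N f a n) = preimageMk N f' (a + u n) n := by
    rw [← hone f', ← hu, ← hinl, ← map_mul, hone, add_zero]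
  refine ⟨u, fun n m => ?_, fun h n m hm => ?_⟩
  · have h1 := map_mul ψ (preimageMk N f 0 n) (preimageMk N f 0 m)
    rw [preimageMk_mul, hψ, hψ, hψ, preimageMk_mul] at h1
    simpa only [zero_add] using preimageMk_left_inj N h1
  · have h1 : ψ (((cocycleExtension f).restrict N).act h (preimageMk N f 0 n)) =
        ((cocycleExtension f').restrict N).act h (ψ (preimageMk N f 0 n)) := hφ h _
    rw [hu, restrict_act_preimageMk N f' h _ n m hm] at h1
    have h2 := preimageMk_left_inj N (((congrArg ψ (restrict_act_preimageMk N f h 0 n m hm)).trans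
      (hψ _ _)).symm.trans h1)
    rw [map_zero, zero_add] at h2
    rw [← h2]
    abel

end RestrictedExtension

/-! ### Inflation and the fibres of restriction -/

section Inflation

variable {k H : Type u} [CommRing k] [Group H] (N : Subgroup H) [N.Normal] (A : Rep.{u} k H)
  [Representation.IsTrivial (A.ρ.comp N.subtype)]

/-- The inflation of a 2-cocycle of `H/N` to `H`. -/
def inflCocycle (g : cocycles₂ (A.ofQuotient N)) : cocycles₂ A :=
  mapCocycles₂ (QuotientGroup.mk' N) (Rep.resOfQuotientIso A N).hom g

lemma inflCocycle_apply (g : cocycles₂ (A.ofQuotient N)) (h j : H) :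
    inflCocycle N A g (h, j) = g ((h : H ⧸ N), (j : H ⧸ N)) := rfl

lemma inflation_H2π (g : cocycles₂ (A.ofQuotient N)) :
    inflation N A (H2π _ g) = H2π A (inflCocycle N A g) :=
  H2π_comp_map_apply (QuotientGroup.mk' N) (Rep.resOfQuotientIso A N).hom g

/-- Two cocycles are cohomologous as soon as a cochain `c` has their difference as coboundary. -/
lemma H2π_eq_of_cochain {K : Type u} [Group K] {B : Rep.{u} k K} (f f' : cocycles₂ B) (c : K → B)
    (h : ∀ g j : K, f (g, j) - f' (g, j) = B.ρ g (c j) - c (g * j) + c g) :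
    H2π B f = H2π B f' := by
  rw [H2π_eq_iff]
  exact ⟨c, funext fun x => (h x.1 x.2).symm⟩

lemma exists_cochain_of_H2π_eq {K : Type u} [Group K] {B : Rep.{u} k K} {f f' : cocycles₂ B}
    (h : H2π B f = H2π B f') :
    ∃ c : K → B, ∀ g j : K, f (g, j) - f' (g, j) = B.ρ g (c j) - c (g * j) + c g := by
  rw [H2π_eq_iff] at h
  obtain ⟨c, hc⟩ := h
  exact ⟨c, fun g j => (congrFun hc (g, j)).symm⟩

/-- Adding an inflated class does not change the restriction to `N`. -/
lemma gamma_add_inflation (x : H2 A) (y : H2 (A.ofQuotient N)) :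
    gamma N A (x + inflation N A y) = gamma N A x := by
  induction x using H2_induction_on with | _ f =>
  induction y using H2_induction_on with | _ g =>
  rw [inflation_H2π, ← map_add, gamma_H2π, gamma_H2π]
  have hg (h : H) (n : N) : inflCocycle N A g (h, n) = A.ρ h (g (1, 1)) := by
    have : ((n : H) : H ⧸ N) = 1 := (QuotientGroup.eq_one_iff _).2 n.2
    rw [inflCocycle_apply, this]
    exact cocycles₂_map_one_snd g (h : H ⧸ N)
  have hg' (h : H) (n : N) : inflCocycle N A g (n, h) = g (1, 1) := by
    have : ((n : H) : H ⧸ N) = 1 := (QuotientGroup.eq_one_iff _).2 n.2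
    rw [inflCocycle_apply, this]
    exact cocycles₂_map_one_fst g (h : H ⧸ N)
  -- On `N` the inflated cocycle is constant, so a constant cochain trivializes it there.
  refine Quotient.sound (restrict_cocycleExtension_equiv_of_cochain N _ _ (fun _ => g (1, 1))
    (fun n m => ?_) (fun h n m hm => ?_))
  · change f (n, m) + inflCocycle N A g (n, m) + g (1, 1) = _
    rw [hg' m n]
    abel
  · change A.ρ h (g (1, 1)) + f (h, n) - f (m, h) = g (1, 1) + (f (h, n) +
      inflCocycle N A g (h, n)) - (f (m, h) + inflCocycle N A g (m, h))
    rw [hg, hg']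
    abel

/-- A 2-cocycle of `H` that is invariant under translation by `N` in both variables is inflated
from `H/N`. -/
lemma exists_inflCocycle_eq (e : cocycles₂ A)
    (hl : ∀ (n : N) (g h : H), e (n * g, h) = e (g, h))
    (hr : ∀ (n : N) (g h : H), e (g, n * h) = e (g, h)) :
    ∃ g : cocycles₂ (A.ofQuotient N), inflCocycle N A g = e := by
  have hN {g g' : H} (h : (g : H ⧸ N) = g') : ∃ n : N, g = n * g' := by
    refine ⟨⟨g * g'⁻¹, ?_⟩, by simp⟩
    rw [← QuotientGroup.eq_one_iff, QuotientGroup.mk_mul, QuotientGroup.mk_inv, h, mul_inv_cancel]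
  have key {g g' h h' : H} (h1 : (g : H ⧸ N) = g') (h2 : (h : H ⧸ N) = h') :
      e (g, h) = e (g', h') := by
    obtain ⟨n, rfl⟩ := hN h1
    obtain ⟨m, rfl⟩ := hN h2
    rw [hl, hr]
  refine ⟨⟨fun pq => e (pq.1.out, pq.2.out), ?_⟩, ?_⟩
  · rw [mem_cocycles₂_iff]
    intro p q r
    have h1 : (A.ofQuotient N).ρ p (e (q.out, r.out)) = A.ρ p.out (e (q.out, r.out)) := by
      conv_lhs => rw [← QuotientGroup.out_eq' p]
      rfl
    change e ((p * q).out, r.out) + e (p.out, q.out) =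
      (A.ofQuotient N).ρ p (e (q.out, r.out)) + e (p.out, (q * r).out)
    rw [h1, key (g := (p * q).out) (g' := p.out * q.out) (by simp) rfl,
      key (h := (q * r).out) (h' := q.out * r.out) rfl (by simp)]
    exact cocycle_rel e p.out q.out r.out
  · ext g h
    exact key (by simp) (by simp)

/-- If two classes have the same restriction to `N`, their difference is inflated from `H/N`.
A congruence of the restrictions is an `H`-equivariant splitting over `N` of the extension `E` of
`H` that belongs to the difference. A section of `E → H` that extends this splitting `N`-linearly
has a factor set that is invariant under translation by `N`. -/
lemma exists_inflation_eq_sub (x y : H2 A) (hxy : gamma N A x = gamma N A y) :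
    ∃ z : H2 (A.ofQuotient N), inflation N A z = x - y := by
  induction x using H2_induction_on with | _ f =>
  induction y using H2_induction_on with | _ f' =>
  rw [gamma_H2π, gamma_H2π] at hxy
  obtain ⟨u, hmul, hconj⟩ :=
    exists_cochain_of_restrict_cocycleExtension_equiv N f f' (Quotient.exact hxy)
  set d : cocycles₂ A := f - f' with hd
  have hdapp (g h : H) : d (g, h) = f (g, h) - f' (g, h) := rfl
  have hdmul (n m : N) : d (n, m) = u n + u m - u (n * m) := by
    rw [hdapp, sub_eq_iff_eq_add, sub_add_eq_add_sub, ← hmul]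
    abel
  have hdconj (h : H) (n m : N) (hm : (m : H) = h * n * h⁻¹) :
      d (h, n) - d (m, h) = A.ρ h (u n) - u m := by
    have h1 := hconj h n m hm
    rw [hdapp, hdapp, sub_eq_sub_iff_add_eq_add]
    rw [sub_eq_sub_iff_add_eq_add] at h1
    have h2 : (A.ρ h) (u n) + f' (h, ↑n) + f (↑m, h) - f' (h, n) - f' (m, h) =
      u m + f (h, ↑n) + f' (↑m, h) - f' (h, n) - f' (m, h) := by rw [h1]
    calc _ = u m + f (h, ↑n) + f' (↑m, h) - f' (h, n) - f' (m, h) := by abel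
      _ = _ := by rw [← h2]; abel
  -- `h ↦ (c h, h)` is the section of `A × H → H`, with multiplication given by `d`, that sends
  -- `n s` to `(-u n, n) (0, s)` for `n : N` and `s` a representative of a class in `H/N`.
  let ν (h : H) : N := ⟨h * (h : H ⧸ N).out⁻¹, by
    rw [← QuotientGroup.eq_one_iff]
    simp⟩
  let c (h : H) : A := -u (ν h) + d (ν h, (h : H ⧸ N).out)
  have hc (n : N) (h : H) : c (n * h) = -u n + c h + d (n, h) := by
    have h0 : ((n * h : H) : H ⧸ N) = h := by
      rw [QuotientGroup.mk_mul, (QuotientGroup.eq_one_iff (n : H)).2 n.2, one_mul]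
    have h1 : ν (n * h) = n * ν h := by
      apply Subtype.ext
      change n * h * ((n * h : H) : H ⧸ N).out⁻¹ = n * (h * (h : H ⧸ N).out⁻¹)
      rw [h0, mul_assoc]
    have h2 := cocycle_rel d n (ν h) (h : H ⧸ N).out
    have h3 : (ν h : H) * (h : H ⧸ N).out = h := inv_mul_cancel_right _ _
    rw [h3, rho_of_mem] at h2
    change -u (ν (n * h)) + d (ν (n * h), ((n * h : H) : H ⧸ N).out) =
      -u n + (-u (ν h) + d (ν h, (h : H ⧸ N).out)) + d (n, h)
    rw [h0, h1, Subgroup.coe_mul, add_assoc (-u n), add_assoc (-u (ν h)), ← h2, hdmul]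
    abel
  let e : cocycles₂ A := d + ⟨(d₁₂ A).hom c, coboundaries₂_le_cocycles₂ A ⟨c, rfl⟩⟩
  have he (g h : H) : e (g, h) = d (g, h) + (A.ρ g (c h) - c (g * h) + c g) := rfl
  have hed : H2π A e = H2π A d :=
    H2π_eq_of_cochain e d c fun g h => by rw [he, add_sub_cancel_left]
  obtain ⟨g, hg⟩ := exists_inflCocycle_eq N A e
    (fun n g h => by
      have h1 := cocycle_rel d n g h
      rw [rho_of_mem] at h1
      rw [he, he, mul_assoc, hc, hc, map_mul, Module.End.mul_apply, rho_of_mem,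
        eq_sub_of_add_eq h1]
      abel)
    (fun n g h => by
      let m : N := ⟨g * n * g⁻¹, Subgroup.Normal.conj_mem inferInstance _ n.2 _⟩
      have hm : (m : H) = g * n * g⁻¹ := rfl
      have hmg : (m : H) * g = g * n := by rw [hm]; group
      have h1 := cocycle_rel d g n h
      have h2 := cocycle_rel d m g h
      have h3 := hdconj g n m hm
      rw [rho_of_mem, hmg] at h2
      have h4 : g * (n * h) = m * (g * h) := by rw [← mul_assoc, ← mul_assoc, hmg]
      rw [he, he, h4, hc, hc, map_add, map_add, map_neg]
      rw [sub_eq_iff_eq_add] at h3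
      rw [add_comm, h3] at h1
      rw [← eq_sub_iff_add_eq] at h2
      rw [← sub_eq_iff_eq_add'.2 h1, h2]
      abel)
  exact ⟨H2π _ g, by rw [inflation_H2π, hg, hed, hd, map_sub]⟩

end Inflation

/-! ### Transgression and the kernel of inflation -/

section Transgression

variable {k H : Type u} [CommRing k] [Group H] (N : Subgroup H) [N.Normal] (A : Rep.{u} k H)
  [Representation.IsTrivial (A.ρ.comp N.subtype)]

/-- An `H`-equivariant homomorphism `N → A` represents an invariant class in `H¹(N, A)`. -/
lemma exists_H1inv_homOfH1_eq (x : Additive N →+ A)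
    (hx : ∀ (h : H) (n m : N), (m : H) = h * n * h⁻¹ → x (.ofMul m) = A.ρ h (x (.ofMul n))) :
    ∃ y : H1inv N A, ∀ n : N, homOfH1 N A y.1 (.ofMul n) = x (.ofMul n) := by
  let f : cocycles₁ (Rep.res N.subtype A) := (cocycles₁IsoOfIsTrivial (Rep.res N.subtype A)).inv x
  have hf (n : N) : f n = x (.ofMul n) := rfl
  refine ⟨⟨H1π _ f, fun p => ?_⟩, fun n => homOfH1_H1π N A f n⟩
  induction p using QuotientGroup.induction_on with | _ h =>
  change H1conj N A h (H1π _ f) = H1π _ f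
  rw [H1conj_H1π]
  congr 1
  ext n
  rw [mapCocycles₁_conj_apply, hf, hf]
  refine (hx h _ n ?_).symm
  change (n : H) = h * (h⁻¹ * n * h⁻¹⁻¹) * h⁻¹
  group

lemma delta_apply (x : H1inv N A) : delta N A x = H2π _ (deltaCocycle N A x) := rfl

/-- The map `x`, evaluated on the `N`-component of `h` with respect to a section of `H → H/N`,
trivializes the inflation of the transgression of `x`. -/
lemma inflation_delta (x : H1inv N A) : inflation N A (delta N A x) = 0 := by
  have h0 : inflation N A (-delta N A x) = 0 := by
    let ν (h : H) : N := ⟨h * (h : H ⧸ N).out⁻¹, by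
      rw [← QuotientGroup.eq_one_iff]
      simp⟩
    rw [delta_apply, ← map_neg, inflation_H2π, ← map_zero (H2π A).hom]
    refine H2π_eq_of_cochain _ _ (fun h => homOfH1 N A x.1 (.ofMul (ν h))) fun g h => ?_
    let m : N := ⟨g * ν h * g⁻¹, Subgroup.Normal.conj_mem inferInstance _ (ν h).2 _⟩
    -- With `s` the section, `g h` is `(g ν(h) g⁻¹) ν(g) s(g) s(h)`.
    have h1 : m * ν g * factorSet N g h = ν (g * h) := by
      apply Subtype.ext
      change (g * (h * (h : H ⧸ N).out⁻¹) * g⁻¹) * (g * (g : H ⧸ N).out⁻¹) *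
          ((g : H ⧸ N).out * (h : H ⧸ N).out * ((g : H ⧸ N) * (h : H ⧸ N)).out⁻¹) =
        g * h * ((g * h : H) : H ⧸ N).out⁻¹
      rw [QuotientGroup.mk_mul]
      group
    have h2 := congrArg (fun n => homOfH1 N A x.1 (.ofMul n)) h1
    simp only [ofMul_mul, map_add] at h2
    rw [homOfH1_conj N A x g (ν h) m rfl] at h2
    change -(homOfH1 N A x.1 (.ofMul (factorSet N g h))) - 0 = _
    rw [← h2]
    abel
  rwa [map_neg, neg_eq_zero] at h0

/-- The kernel of inflation is the image of the transgression. If the inflation of a cocycle `g` of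
`H/N` is the coboundary of `c`, then `n ↦ c(n) - c(1)` is an equivariant homomorphism on `N`, and
restricting `c` to representatives of `H/N` shows that `g` is cohomologous to the negative of the
transgression of this homomorphism. -/
lemma inflation_eq_zero_iff (y : H2 (A.ofQuotient N)) :
    inflation N A y = 0 ↔ y ∈ LinearMap.range (delta N A) := by
  refine ⟨fun hy => ?_, fun ⟨x, hx⟩ => hx ▸ inflation_delta N A x⟩
  induction y using H2_induction_on with | _ g =>
  rw [inflation_H2π, ← map_zero (H2π A).hom] at hy
  obtain ⟨c, hc⟩ := exists_cochain_of_H2π_eq hy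
  have hcg (h j : H) : g ((h : H ⧸ N), (j : H ⧸ N)) = A.ρ h (c j) - c (h * j) + c h :=
    (sub_zero _).symm.trans (hc h j)
  have hN (n : N) : ((n : H) : H ⧸ N) = 1 := (QuotientGroup.eq_one_iff _).2 n.2
  have hone : g (1, 1) = c 1 := by
    have h1 := hcg 1 1
    rw [mul_one, rho_one_apply, sub_self, zero_add] at h1
    exact h1
  have hl (n : N) (h : H) : c (n * h) = c n - c 1 + c h := by
    have h1 := hcg n h
    rw [hN, cocycles₂_map_one_fst g (h : H ⧸ N), hone, rho_of_mem] at h1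
    rw [h1]
    abel
  have hr (n : N) (h : H) : c (h * n) = A.ρ h (c n - c 1) + c h := by
    have h1 := hcg h n
    have h2 : g ((h : H ⧸ N), 1) = A.ρ h (g (1, 1)) := cocycles₂_map_one_snd g (h : H ⧸ N)
    rw [hN, h2, hone] at h1
    rw [map_sub, h1]
    abel
  let x : Additive N →+ A :=
    AddMonoidHom.mk' (fun n => c n.toMul - c 1) fun n m => by
      change c (n.toMul * m.toMul : N) - c 1 = _
      rw [Subgroup.coe_mul, hl]
      abel
  obtain ⟨z, hz⟩ := exists_H1inv_homOfH1_eq N A x fun h n m hm => by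
    change c m - c 1 = A.ρ h (c n - c 1)
    have h1 := hl m h
    rw [show (m : H) * h = h * n by rw [hm]; group, hr] at h1
    exact (add_right_cancel h1).symm
  refine ⟨-z, ?_⟩
  rw [map_neg, delta_apply]
  refine (map_neg (H2π _).hom _).symm.trans ?_
  refine (H2π_eq_of_cochain (K := H ⧸ N) (B := A.ofQuotient N) g (-deltaCocycle N A z)
    (fun p => c p.out) fun p q => ?_).symm
  have h1 : (factorSet N p q : H) * (p * q).out = p.out * q.out := inv_mul_cancel_right _ _
  have h2 := hl (factorSet N p q) (p * q).out
  have h3 := hcg p.out q.out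
  rw [h1] at h2
  rw [h2, QuotientGroup.out_eq', QuotientGroup.out_eq'] at h3
  have h4 : (A.ofQuotient N).ρ p (c q.out) = A.ρ p.out (c q.out) := by
    conv_lhs => rw [← QuotientGroup.out_eq' p]
    rfl
  change g (p, q) - -(homOfH1 N A z.1 (.ofMul (factorSet N p q))) = _
  rw [hz, h4, h3]
  change _ - -(c (factorSet N p q) - c 1) = _
  abel

end Transgression

end CoverUniqueness

end

/-! ### The action on the fibre over the universal cover -/

theorem theorem3p2 (G : Type u) [TopologicalSpace G] [Group G] [IsTopologicalGroup G]
    [LocallyPathConnectedSpace G] (hG : SemilocallySimplyConnected G) :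
    ∃ act : AddAction (H2 (pi1Rep0 G)) (EPsi G),
      (∀ (τ : H2 (pi1Rep0 G)) (μ : EPsi G),
        ((τ +ᵥ μ : EPsi G) : H2 (pi1Rep G)) = μ + inflation (G0 G) (pi1Rep G) τ) ∧
      (∀ μ ν : EPsi G, ∃ τ : H2 (pi1Rep0 G), τ +ᵥ μ = ν) ∧
      (∀ (μ : EPsi G) (τ : H2 (pi1Rep0 G)), τ +ᵥ μ = μ ↔ τ ∈ imDelta G) ∧
      ((EPsi G).Nonempty →
        ∀ τ : H2 (pi1Rep0 G), (∀ μ : EPsi G, τ +ᵥ μ = μ) ↔ τ ∈ imDelta G) ∧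
      (∃ act' : AddAction (H2 (pi1Rep0 G) ⧸ imDelta G) (EPsi G),
        (∀ (τ : H2 (pi1Rep0 G)) (μ : EPsi G),
          (Submodule.Quotient.mk τ : H2 (pi1Rep0 G) ⧸ imDelta G) +ᵥ μ = τ +ᵥ μ) ∧
        (∀ μ ν : EPsi G, ∃ q : H2 (pi1Rep0 G) ⧸ imDelta G, q +ᵥ μ = ν) ∧
        (∀ (μ : EPsi G) (q : H2 (pi1Rep0 G) ⧸ imDelta G), q +ᵥ μ = μ → q = 0)) ∧
      (Subsingleton (H2 (pi1Rep0 G) ⧸ imDelta G) → (EPsi G).encard ≤ 1) ∧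
      ((EPsi G).Nonempty →
        (Subsingleton (H2 (pi1Rep0 G) ⧸ imDelta G) ↔ (EPsi G).encard ≤ 1)) := by
  have vadd_mem (τ : H2 (pi1Rep0 G)) (μ : EPsi G) :
      (μ : H2 (pi1Rep G)) + inflation (G0 G) (pi1Rep G) τ ∈ EPsi G :=
    (gamma_add_inflation (G0 G) (pi1Rep G) μ τ).trans μ.2
  have trans (μ ν : EPsi G) : ∃ τ : H2 (pi1Rep0 G),
      (μ : H2 (pi1Rep G)) + inflation (G0 G) (pi1Rep G) τ = ν := by
    obtain ⟨τ, hτ⟩ := exists_inflation_eq_sub (G0 G) (pi1Rep G) ν μ (ν.2.trans μ.2.symm)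
    exact ⟨τ, by rw [hτ, add_sub_cancel]⟩
  have stab (μ : H2 (pi1Rep G)) (τ : H2 (pi1Rep0 G)) :
      μ + inflation (G0 G) (pi1Rep G) τ = μ ↔ τ ∈ imDelta G := by
    rw [add_eq_left]
    exact inflation_eq_zero_iff (G0 G) (pi1Rep G) τ
  let infl' : (H2 (pi1Rep0 G) ⧸ imDelta G) →ₗ[IntU.{u}] H2 (pi1Rep G) :=
    (imDelta G).liftQ (inflation (G0 G) (pi1Rep G)) fun τ hτ =>
      (inflation_eq_zero_iff (G0 G) (pi1Rep G) τ).2 hτ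
  have infl'_mk (τ : H2 (pi1Rep0 G)) :
      infl' (Submodule.Quotient.mk τ) = inflation (G0 G) (pi1Rep G) τ := rfl
  have vadd'_mem (q : H2 (pi1Rep0 G) ⧸ imDelta G) (μ : EPsi G) :
      (μ : H2 (pi1Rep G)) + infl' q ∈ EPsi G := by
    obtain ⟨τ, rfl⟩ := Submodule.Quotient.mk_surjective _ q
    exact vadd_mem τ μ
  have sub : Subsingleton (H2 (pi1Rep0 G) ⧸ imDelta G) → (EPsi G).encard ≤ 1 := fun hQ => by
    refine Set.encard_le_one_iff.2 fun μ ν hμ hν => ?_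
    obtain ⟨τ, hτ⟩ := trans ⟨μ, hμ⟩ ⟨ν, hν⟩
    have h1 : τ ∈ imDelta G := (Submodule.Quotient.mk_eq_zero _).1 (Subsingleton.elim _ _)
    exact ((stab μ τ).2 h1).symm.trans hτ
  refine ⟨{ vadd := fun τ μ => ⟨μ + inflation (G0 G) (pi1Rep G) τ, vadd_mem τ μ⟩
            zero_vadd := fun μ => Subtype.ext ((stab μ 0).2 (imDelta G).zero_mem)
            add_vadd := fun σ τ μ => Subtype.ext (by
              change (μ : H2 (pi1Rep G)) + inflation (G0 G) (pi1Rep G) (σ + τ) =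
                μ + inflation (G0 G) (pi1Rep G) τ + inflation (G0 G) (pi1Rep G) σ
              rw [map_add]
              abel) },
    fun _ _ => rfl, fun μ ν => ?_, fun μ τ => ?_, fun ⟨μ, hμ⟩ τ => ?_,
    ⟨{ vadd := fun q μ => ⟨μ + infl' q, vadd'_mem q μ⟩
       zero_vadd := fun μ => Subtype.ext ((stab μ 0).2 (imDelta G).zero_mem)
       add_vadd := fun p q μ => Subtype.ext (by
          change (μ : H2 (pi1Rep G)) + infl' (p + q) = μ + infl' q + infl' p
          rw [map_add]
          abel) },
      fun _ _ => rfl, fun μ ν => ?_, fun μ q hq => ?_⟩, sub, fun ⟨μ, hμ⟩ => ⟨sub, fun hcard => ?_⟩⟩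
  · obtain ⟨τ, hτ⟩ := trans μ ν
    exact ⟨τ, Subtype.ext hτ⟩
  · exact Subtype.ext_iff.trans (stab μ τ)
  · exact ⟨fun h => (stab μ τ).1 (congrArg Subtype.val (h ⟨μ, hμ⟩)),
      fun h ν => Subtype.ext ((stab ν τ).2 h)⟩
  · obtain ⟨τ, hτ⟩ := trans μ ν
    exact ⟨Submodule.Quotient.mk τ, Subtype.ext hτ⟩
  · obtain ⟨τ, rfl⟩ := Submodule.Quotient.mk_surjective _ q
    exact (Submodule.Quotient.mk_eq_zero _).2 ((stab μ τ).1 (congrArg Subtype.val hq))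
  · -- A class outside the image of `Δ` would move `μ` to a second element of the fibre.
    refine Submodule.Quotient.subsingleton_iff.2 (eq_top_iff.2 fun τ _ => (stab μ τ).1 ?_)
    exact Set.encard_le_one_iff.1 hcard _ _ (vadd_mem τ ⟨μ, hμ⟩) hμ
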